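/- Fix a universal machine $U$: a partial computable map taking a binary program $p$ and a conditional input $y\in\mathbb N$ to a binary string (when defined), such that every partial computable $V$ of this kind has a finite binary string $c$ with $U(cp,y)=V(p,y)$ for all $p,y$ (both sides undefined together). Let $C(x\mid y)$ be the least length of a program $p$ with $U(p,y)=x$. A labeled graph $G$ on the nodes $\{1,\dots,n\}$ is identified with the binary string $E(G)$ of length $\binom n2$ listing, in lexicographic order of the pairs $i<j$, whether $\{i,j\}$ is an edge. For $\delta:\mathbb N\to\mathbb R$, $G$ is called $\delta(n)$-random if $C(E(G)\mid n)\ge\binom n2-\delta(n)$. A graph is called $k$-connected if between every two distinct nodes there are at least $k$ distinct paths that pairwise share no nodes other than the two end nodes. Then every $o(n)$-random labeled graph is $(n/4+o(n))$-connected: for every $\delta:\mathbb N\to\mathbb R$ with $\delta(n)=o(n)$ there is a function $\kappa:\mathbb N\to\mathbb N$ with $\kappa(n)=n/4+o(n)$ such that, for every $n$, every $\delta(n)$-random labeled graph on $n$ nodes is $\kappa(n)$-connected. -/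

import Mathlib

open Filter Asymptotics

/-- A machine takes a binary program and a conditional input, which is a natural number (natural
numbers being identified with binary strings), and may output a binary string. It is *computable*
when it is partial recursive, that is, when a Turing machine computes it. -/
abbrev Machine : Type := List Bool → ℕ →. List Bool

/-- `U` is a universal machine: it is computable, and each computable machine `V` has a finite
self-delimiting description `c` such that `U`, given `c` followed by a program `p` of `V`,
does what `V` does on `p`, for every input `y` (diverging when `V` diverges). -/
def IsUniversal (U : Machine) : Prop :=
  Partrec₂ U ∧ ∀ V : Machine, Partrec₂ V → ∃ c : List Bool, ∀ p y, U (c ++ p) y = V p y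

/-- A concrete machine: on `1^k 0 p` and `y` it runs the `k`-th partial recursive function
on (a code of) the pair `(p, y)`. -/
def referenceMachine : Machine := fun s y =>
  ((Denumerable.ofNat Nat.Partrec.Code (s.idxOf false)).eval
      (Encodable.encode (s.drop (s.idxOf false + 1), y))).bind
    fun m => (Encodable.decode (α := List Bool) m : Part (List Bool))

/-- Universal machines exist. -/
theorem isUniversal_referenceMachine : IsUniversal referenceMachine := by
  constructor
  · have hidx : Primrec (fun s : List Bool => s.idxOf false) :=
      Primrec.list_idxOf.comp (Primrec.const false) Primrec.id
    have h1 : Computable fun a : List Bool × ℕ =>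
        Denumerable.ofNat Nat.Partrec.Code (a.1.idxOf false) :=
      ((Primrec.ofNat _).comp (hidx.comp Primrec.fst)).to_comp
    have h2 : Computable fun a : List Bool × ℕ =>
        Encodable.encode (a.1.drop (a.1.idxOf false + 1), a.2) :=
      (Primrec.encode.comp ((Primrec.list_drop.comp
        (Primrec.succ.comp (hidx.comp Primrec.fst)) Primrec.fst).pair Primrec.snd)).to_comp
    refine (Nat.Partrec.Code.eval_part.comp h1 h2).bind ?_
    exact (Computable.ofOption (Computable.decode.comp Computable.snd))
  · intro V hV
    obtain ⟨c, hc⟩ := Nat.Partrec.Code.exists_code.1 hV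
    refine ⟨List.replicate (Encodable.encode c) true ++ [false], fun p y => ?_⟩
    have hi : (List.replicate (Encodable.encode c) true ++ [false] ++ p).idxOf false
        = Encodable.encode c := by
      rw [List.append_assoc, List.idxOf_append_of_notMem (by simp)]
      simp
    have hd : (List.replicate (Encodable.encode c) true ++ [false] ++ p).drop
        (Encodable.encode c + 1) = p := by
      rw [List.drop_append_of_le_length (by simp)]; simp
    unfold referenceMachine
    rw [hi, hd, Denumerable.ofNat_encode, hc]
    simp [Part.bind_map]

/-- The conditional Kolmogorov complexity `C(x | y)` with respect to the machine `U`: the least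
length of a program for which `U`, on input `y`, outputs `x`. (For a universal `U` there is always
such a program.) -/
noncomputable def condComplexity (U : Machine) (x : List Bool) (y : ℕ) : ℕ :=
  sInf {l | ∃ p : List Bool, p.length = l ∧ x ∈ U p y}

open Classical in
/-- The binary string of length `n.choose 2` that represents a labeled graph on `n` nodes: its bits
indicate presence or absence of the edges `{i, j}`, `i < j`, in lexicographic order. -/
noncomputable def edgeString {n : ℕ} (G : SimpleGraph (Fin n)) : List Bool :=
  (List.finRange n).flatMap fun i =>
    ((List.finRange n).filter fun j => i < j).map fun j => decide (G.Adj i j)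

/-- A labeled graph on `n` nodes is `δ(n)`-random: its randomness deficiency is at most `δ(n)`. -/
def IsRandomGraph (U : Machine) (δ : ℕ → ℝ) {n : ℕ} (G : SimpleGraph (Fin n)) : Prop :=
  (n.choose 2 : ℝ) - δ n ≤ (condComplexity U (edgeString G) n : ℝ)

/-- A graph is `k`-connected if there are at least `k` (internally) node-disjoint paths between
every pair of nodes. -/
def IsKConnected {V : Type*} (G : SimpleGraph V) (k : ℕ) : Prop :=
  ∀ i j : V, i ≠ j → ∃ S : Finset (G.Path i j), k ≤ S.card ∧
    ∀ P ∈ S, ∀ Q ∈ S, P ≠ Q → ∀ v : V, v ∈ P.1.support → v ∈ Q.1.support → v = i ∨ v = j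

/-! Each common neighbor of two nodes gives a path of length two between them, and these paths share
no inner nodes. So it is enough that any two nodes of a random graph have at least n/4 - o(n) common
neighbors.

Fix q. In a uniformly chosen graph the common neighbors of a given pair number Binomial(n - 2, 1/4),
so a Chernoff bound (`card_sparse_pair_le`, via the generating function `sum_pow_card_testBit`) and
a union bound show that only a fraction 2^(-γn), with γ > 0 depending on q, of all graphs has a pair
with fewer than qn/(4q+1) common neighbors. This property is decidable, so a machine depending only
on q can list these sparse graphs given n; an index in the list describes such a graph with about γn
bits fewer than its edge string. For large n this exceeds the deficiency o(n), so random graphs are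
not sparse. Since q/(4q+1) tends to 1/4, the theorem follows. The rational threshold keeps the test
in natural numbers. -/

/-! ### Graphs coded as numbers, and a machine listing the sparse ones -/

/-- The pairs `(i, j)` with `i < j < n`, in lexicographic order. -/
def edgePairs (n : ℕ) : List (ℕ × ℕ) :=
  (List.range n).flatMap fun i => ((List.range n).filter fun j => i < j).map fun j => (i, j)

/-- The position of the edge `{a, b}` in the edge string of a graph on `n` nodes. -/
def edgeIndex (n a b : ℕ) : ℕ := (edgePairs n).idxOf (min a b, max a b)

/-- The nodes `k < n` adjacent to both `a` and `b`, in the graph on `n` nodes whose edge string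
consists of the binary digits of `r`. -/
def commonNeighborList (n r a b : ℕ) : List ℕ :=
  (List.range n).filter fun k =>
    r.testBit (edgeIndex n a k) = true ∧ r.testBit (edgeIndex n b k) = true

/-- Some two nodes of the graph coded by `r` have less than `q * n / (4 * q + 1)` common
neighbors. -/
def IsSparseCode (q n r : ℕ) : Prop :=
  ∃ e ∈ edgePairs n, (4 * q + 1) * (commonNeighborList n r e.1 e.2).length < q * n

instance (q n r : ℕ) : Decidable (IsSparseCode q n r) := by
  unfold IsSparseCode; infer_instance

/-- The codes of graphs on `n` nodes in which some two nodes have few common neighbors. -/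
def sparseCodes (q n : ℕ) : List ℕ :=
  (List.range (2 ^ (edgePairs n).length)).filter fun r => IsSparseCode q n r

/-- The number with binary digits `p`, least significant digit first. -/
def bitsValue (p : List Bool) : ℕ := p.foldr (fun b v => 2 * v + cond b 1 0) 0

/-- The first `m` binary digits of `r`. -/
def bitString (m r : ℕ) : List Bool := (List.range m).map fun i => r.testBit i

/-- The machine that outputs the edge string of a graph with a sparse pair, given its index among
all these graphs. -/
def sparseMachine (q : ℕ) : Machine := fun p n =>
  (((sparseCodes q n)[bitsValue p]?.map (bitString (edgePairs n).length) :
    Option (List Bool)) : Part (List Bool))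

/-! ### Computability of the machine -/

theorem Primrec.filter_rel {α β : Type*} [Primcodable α] [Primcodable β] {f : α → List β}
    {p : α → β → Prop} [∀ a, DecidablePred (p a)] (hf : Primrec f) (hp : PrimrecRel p) :
    Primrec fun a => (f a).filter fun b => p a b := by
  have h : PrimrecRel fun (b : β) (a : α) => p a b := hp.comp Primrec.snd Primrec.fst
  have : DecidableRel fun (b : β) (a : α) => p a b := fun b a => inferInstanceAs (Decidable (p a b))
  exact (h.listFilter.comp hf Primrec.id).of_eq fun a => List.filter_congr fun b _ => by simp

theorem PrimrecPred.exists_mem_list_rel {α β : Type*} [Primcodable α] [Primcodable β]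
    {f : α → List β} {p : α → β → Prop} (hf : Primrec f) (hp : PrimrecRel p) :
    PrimrecPred fun a => ∃ b ∈ f a, p a b := by
  have h : PrimrecRel fun (b : β) (a : α) => p a b := hp.comp Primrec.snd Primrec.fst
  exact h.exists_mem_list.comp hf Primrec.id

theorem Primrec.nat_two_pow : Primrec fun n : ℕ => 2 ^ n := by
  refine (Primrec.nat_rec₁ (f := fun _ v => 2 * v) 1 ?_).of_eq fun n => ?_
  · exact (Primrec.nat_mul.comp (Primrec.const 2) Primrec.snd).to₂
  · induction n with
    | zero => rfl
    | succ n ih => rw [pow_succ, ← ih]; exact mul_comm _ _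

theorem PrimrecRel.testBit : PrimrecRel fun r i : ℕ => r.testBit i = true := by
  have h : PrimrecPred fun x : ℕ × ℕ => x.1 / 2 ^ x.2 % 2 = 1 :=
    Primrec.eq.comp (Primrec.nat_mod.comp (Primrec.nat_div.comp Primrec.fst
      (Primrec.nat_two_pow.comp Primrec.snd)) (Primrec.const 2)) (Primrec.const 1)
  exact h.of_eq fun x => by simp [Nat.testBit_eq_decide_div_mod_eq]

theorem Primrec.edgePairs : Primrec edgePairs := by
  refine Primrec.list_flatMap Primrec.list_range ?_
  refine Primrec.list_map (f := fun x : ℕ × ℕ => (List.range x.1).filter fun j => x.2 < j)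
    (g := fun x j => (x.2, j)) ?_ ?_
  · exact Primrec.filter_rel (p := fun (x : ℕ × ℕ) j => x.2 < j)
      (Primrec.list_range.comp Primrec.fst)
      (Primrec.nat_lt.comp (Primrec.snd.comp Primrec.fst) Primrec.snd)
  · exact (Primrec.pair (Primrec.snd.comp Primrec.fst) Primrec.snd).to₂

theorem Primrec.edgeIndex {α : Type*} [Primcodable α] {f g h : α → ℕ} (hf : Primrec f)
    (hg : Primrec g) (hh : Primrec h) : Primrec fun x => edgeIndex (f x) (g x) (h x) :=
  (Primrec.list_idxOf.comp
    (Primrec.pair (Primrec.nat_min.comp hg hh) (Primrec.nat_max.comp hg hh))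
    (Primrec.edgePairs.comp hf)).of_eq fun x => by
      unfold _root_.edgeIndex
      congr 1
      exact lawful_beq_subsingleton _ _

theorem Primrec.commonNeighborList :
    Primrec fun x : (ℕ × ℕ) × ℕ × ℕ => commonNeighborList x.1.1 x.1.2 x.2.1 x.2.2 := by
  have hn : Primrec fun y : ((ℕ × ℕ) × ℕ × ℕ) × ℕ => y.1.1.1 :=
    Primrec.fst.comp (Primrec.fst.comp Primrec.fst)
  have hr : Primrec fun y : ((ℕ × ℕ) × ℕ × ℕ) × ℕ => y.1.1.2 :=
    Primrec.snd.comp (Primrec.fst.comp Primrec.fst)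
  have ha : Primrec fun y : ((ℕ × ℕ) × ℕ × ℕ) × ℕ => y.1.2.1 :=
    Primrec.fst.comp (Primrec.snd.comp Primrec.fst)
  have hb : Primrec fun y : ((ℕ × ℕ) × ℕ × ℕ) × ℕ => y.1.2.2 :=
    Primrec.snd.comp (Primrec.snd.comp Primrec.fst)
  refine Primrec.filter_rel
    (p := fun (x : (ℕ × ℕ) × ℕ × ℕ) k => x.1.2.testBit (_root_.edgeIndex x.1.1 x.2.1 k) = true ∧
      x.1.2.testBit (_root_.edgeIndex x.1.1 x.2.2 k) = true)
    (Primrec.list_range.comp (Primrec.fst.comp Primrec.fst)) ?_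
  exact (PrimrecRel.testBit.comp hr (Primrec.edgeIndex hn ha Primrec.snd)).and
    (PrimrecRel.testBit.comp hr (Primrec.edgeIndex hn hb Primrec.snd))

theorem PrimrecRel.isSparseCode (q : ℕ) : PrimrecRel (IsSparseCode q) := by
  refine PrimrecPred.exists_mem_list_rel (f := fun x : ℕ × ℕ => _root_.edgePairs x.1)
    (p := fun x e => (4 * q + 1) * (_root_.commonNeighborList x.1 x.2 e.1 e.2).length < q * x.1)
    (Primrec.edgePairs.comp Primrec.fst) ?_
  exact Primrec.nat_lt.comp
    (Primrec.nat_mul.comp (Primrec.const _) (Primrec.list_length.comp Primrec.commonNeighborList))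
    (Primrec.nat_mul.comp (Primrec.const q) (Primrec.fst.comp Primrec.fst))

theorem Primrec.edgePairs_length : Primrec fun n => (_root_.edgePairs n).length :=
  Primrec.list_length.comp Primrec.edgePairs

theorem Primrec.sparseCodes (q : ℕ) : Primrec (sparseCodes q) :=
  Primrec.filter_rel (Primrec.list_range.comp (Primrec.nat_two_pow.comp Primrec.edgePairs_length))
    (PrimrecRel.isSparseCode q)

theorem Primrec.bitsValue : Primrec bitsValue := by
  refine Primrec.list_foldr (h := fun _ (x : Bool × ℕ) => 2 * x.2 + _root_.cond x.1 1 0) Primrec.id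
    (Primrec.const 0) ?_
  exact (Primrec.nat_add.comp
    (Primrec.nat_mul.comp (Primrec.const 2) (Primrec.snd.comp Primrec.snd))
    (Primrec.cond (Primrec.fst.comp Primrec.snd) (Primrec.const (1 : ℕ)) (Primrec.const 0))).to₂

theorem Primrec.bitString : Primrec₂ bitString := by
  refine Primrec.list_map (f := fun x : ℕ × ℕ => List.range x.1)
    (g := fun x i => x.2.testBit i) (Primrec.list_range.comp Primrec.fst) ?_
  have h := (PrimrecRel.testBit.comp (Primrec.snd.comp Primrec.fst)
    (Primrec.snd (α := ℕ × ℕ) (β := ℕ))).decide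
  exact h.of_eq fun x => by simp

theorem partrec_sparseMachine (q : ℕ) : Partrec₂ (sparseMachine q) := by
  refine Computable.ofOption (Primrec.to_comp ?_)
  refine Primrec.option_map (Primrec.list_getElem?.comp
    ((Primrec.sparseCodes q).comp Primrec.snd) (Primrec.bitsValue.comp Primrec.fst)) ?_
  exact Primrec.bitString.comp
    (Primrec.edgePairs_length.comp (Primrec.snd.comp Primrec.fst)) Primrec.snd

/-! ### Short descriptions of sparse graphs -/

theorem exists_bitsValue_eq (l : ℕ) : ∀ v < 2 ^ l,
    ∃ p : List Bool, p.length = l ∧ bitsValue p = v := by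
  induction l with
  | zero => exact fun v hv => ⟨[], rfl, by simp at hv; simp [hv, bitsValue]⟩
  | succ l ih =>
    intro v hv
    obtain ⟨p, hp, hpv⟩ := ih (v / 2) (by omega)
    refine ⟨decide (v % 2 = 1) :: p, by simp [hp], ?_⟩
    have h : bitsValue (decide (v % 2 = 1) :: p)
      = 2 * bitsValue p + cond (decide (v % 2 = 1)) 1 0 := rfl
    rw [h, hpv]
    rcases Nat.mod_two_eq_zero_or_one v with h0 | h0 <;> simp [h0] <;> omega

/-- Graphs with a sparse pair of nodes are compressible. -/
theorem exists_condComplexity_le {U : Machine} (hU : IsUniversal U) (q : ℕ) :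
    ∃ c : ℕ, ∀ n l r, (sparseCodes q n).length ≤ 2 ^ l → r ∈ sparseCodes q n →
      condComplexity U (bitString (edgePairs n).length r) n ≤ c + l := by
  obtain ⟨c, hc⟩ := hU.2 _ (partrec_sparseMachine q)
  refine ⟨c.length, fun n l r hl hr => ?_⟩
  obtain ⟨v, hv, rfl⟩ := List.mem_iff_getElem.1 hr
  obtain ⟨p, rfl, hpv⟩ := exists_bitsValue_eq l v (hv.trans_le hl)
  refine Nat.sInf_le ⟨c ++ p, by simp, ?_⟩
  rw [hc]
  simp [sparseMachine, hpv, hv]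

/-! ### Edge positions and edge strings -/

theorem mem_edgePairs {n : ℕ} {e : ℕ × ℕ} : e ∈ edgePairs n ↔ e.1 < e.2 ∧ e.2 < n := by
  obtain ⟨a, b⟩ := e
  simp only [edgePairs, List.mem_flatMap, List.mem_range, List.mem_map, List.mem_filter,
    decide_eq_true_eq, Prod.mk.injEq]
  constructor
  · rintro ⟨i, hi, j, ⟨hj, hij⟩, rfl, rfl⟩
    exact ⟨hij, hj⟩
  · rintro ⟨h1, h2⟩
    exact ⟨a, h1.trans h2, b, ⟨h2, h1⟩, rfl, rfl⟩

theorem nodup_edgePairs (n : ℕ) : (edgePairs n).Nodup := by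
  refine List.nodup_flatMap.2 ⟨fun i _ => ?_, ?_⟩
  · exact ((List.nodup_range).filter _).map fun a b h => (Prod.mk.inj h).2
  · refine List.Pairwise.imp ?_ (List.nodup_range (n := n))
    intro a b hab x hx hx'
    simp only [List.mem_map] at hx hx'
    obtain ⟨_, _, rfl⟩ := hx
    obtain ⟨_, _, h⟩ := hx'
    exact hab (Prod.mk.inj h).1.symm

theorem nodup_commonNeighborList (n r a b : ℕ) : (commonNeighborList n r a b).Nodup :=
  List.nodup_range.filter _

theorem nodup_sparseCodes (q n : ℕ) : (sparseCodes q n).Nodup :=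
  List.nodup_range.filter _

theorem length_edgePairs_le (n : ℕ) : (edgePairs n).length ≤ n.choose 2 := by
  rw [← List.toFinset_card_of_nodup (nodup_edgePairs n)]
  have h : (Finset.powersetCard 2 (Finset.range n)).card = n.choose 2 := by simp
  rw [← h]
  refine Finset.card_le_card_of_injOn (fun e => {e.1, e.2}) ?_ ?_
  · intro e he
    have := mem_edgePairs.1 (List.mem_toFinset.1 he)
    rw [Finset.mem_coe, Finset.mem_powersetCard]
    refine ⟨?_, Finset.card_pair this.1.ne⟩
    intro x hx
    simp only [Finset.mem_insert, Finset.mem_singleton] at hx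
    simp only [Finset.mem_range]
    omega
  · rintro ⟨a, b⟩ he ⟨a', b'⟩ he' h
    have h1 := mem_edgePairs.1 (List.mem_toFinset.1 he)
    have h2 := mem_edgePairs.1 (List.mem_toFinset.1 he')
    simp only at h1 h2 h
    have ha : a ∈ ({a', b'} : Finset ℕ) := by rw [← h]; simp
    have hb : b ∈ ({a', b'} : Finset ℕ) := by rw [← h]; simp
    simp only [Finset.mem_insert, Finset.mem_singleton] at ha hb
    ext <;> simp <;> omega

theorem length_edgePairs_le_sq (n : ℕ) : (edgePairs n).length ≤ n ^ 2 :=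
  (length_edgePairs_le n).trans (Nat.choose_le_pow n 2)

theorem minmax_mem_edgePairs {n a b : ℕ} (ha : a < n) (hb : b < n) (h : a ≠ b) :
    (min a b, max a b) ∈ edgePairs n := by
  rw [mem_edgePairs]; simp only; omega

theorem edgeIndex_lt {n a b : ℕ} (ha : a < n) (hb : b < n) (h : a ≠ b) :
    edgeIndex n a b < (edgePairs n).length :=
  List.idxOf_lt_length_of_mem (minmax_mem_edgePairs ha hb h)

/-- The position falls just past the last digit of any code below `2 ^ (edgePairs n).length`, so
that digit reads as 0: no loops. -/
theorem edgeIndex_self (n a : ℕ) : edgeIndex n a a = (edgePairs n).length :=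
  List.idxOf_eq_length fun h => by simpa using (mem_edgePairs.1 h).1

theorem edgeIndex_inj {n a b a' b' : ℕ} (ha : a < n) (hb : b < n) (h : a ≠ b)
    (heq : edgeIndex n a b = edgeIndex n a' b') :
    min a b = min a' b' ∧ max a b = max a' b' :=
  Prod.mk.inj ((List.idxOf_inj (minmax_mem_edgePairs ha hb h)).1 heq)

theorem edgeString_eq_map {n : ℕ} (G : SimpleGraph (Fin n)) (f : ℕ × ℕ → Bool)
    (hf : ∀ i j : Fin n, f (i, j) = true ↔ G.Adj i j) : edgeString G = (edgePairs n).map f := by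
  classical
  have hr : List.range n = (List.finRange n).map Fin.val := by simp
  simp only [edgeString, edgePairs, hr, List.map_flatMap, List.flatMap_map, List.filter_map,
    List.map_map]
  refine List.flatMap_congr fun i _ => ?_
  refine List.map_congr_left fun j _ => ?_
  rw [Bool.eq_iff_iff]
  simp [hf]

/-- Every edge string consists of the binary digits of some number. -/
theorem exists_code {n : ℕ} (G : SimpleGraph (Fin n)) :
    ∃ r < 2 ^ (edgePairs n).length, edgeString G = bitString (edgePairs n).length r ∧
      ∀ i j : Fin n, r.testBit (edgeIndex n i j) = true ↔ G.Adj i j := by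
  classical
  set f : ℕ × ℕ → Bool := fun e => decide (∃ i j : Fin n, e = (↑i, ↑j) ∧ G.Adj i j) with hf
  have hfa : ∀ i j : Fin n, f (i, j) = true ↔ G.Adj i j := by
    intro i j
    simp only [hf, decide_eq_true_eq, Prod.mk.injEq]
    constructor
    · rintro ⟨i', j', ⟨h1, h2⟩, h⟩
      rwa [Fin.ext h1, Fin.ext h2]
    · exact fun h => ⟨i, j, ⟨rfl, rfl⟩, h⟩
  refine ⟨Nat.ofBits fun k : Fin (edgePairs n).length => f ((edgePairs n)[k]),
    Nat.ofBits_lt_two_pow _, ?_, ?_⟩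
  · rw [edgeString_eq_map G f hfa]
    refine List.ext_getElem (by simp [bitString]) fun k h1 h2 => ?_
    simp only [List.length_map] at h1
    simp [bitString, Nat.testBit_ofBits_lt _ _ h1]
  · intro i j
    by_cases hij : i = j
    · subst hij
      rw [edgeIndex_self, Nat.testBit_ofBits_ge _ _ le_rfl]
      simp
    · have hne : (i : ℕ) ≠ j := fun h => hij (Fin.ext h)
      have hlt := edgeIndex_lt i.2 j.2 hne
      rw [Nat.testBit_ofBits_lt _ _ hlt]
      have : (edgePairs n)[edgeIndex n i j] = (min (i : ℕ) j, max (i : ℕ) j) :=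
        List.getElem_idxOf hlt
      simp only [Fin.getElem_fin, this]
      rcases le_total (i : ℕ) j with h | h
      · rw [min_eq_left h, max_eq_right h, hfa]
      · rw [min_eq_right h, max_eq_left h, hfa, G.adj_comm]

/-! ### Counting sparse graphs: a Chernoff bound -/

/-- Flipping one digit is an involution of the numbers below `2 ^ M`. It stands in for the
independence of the digits. -/
theorem sum_xor_two_pow {M a : ℕ} (ha : a < M) (F : ℕ → ℝ) :
    ∑ r ∈ Finset.range (2 ^ M), F (r ^^^ 2 ^ a) = ∑ r ∈ Finset.range (2 ^ M), F r := by
  have hmem : ∀ r ∈ Finset.range (2 ^ M), r ^^^ 2 ^ a ∈ Finset.range (2 ^ M) := by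
    intro r hr
    rw [Finset.mem_range] at hr ⊢
    exact Nat.xor_lt_two_pow hr (Nat.pow_lt_pow_right one_lt_two ha)
  have hinv : ∀ r : ℕ, r ^^^ 2 ^ a ^^^ 2 ^ a = r := fun r => by
    rw [Nat.xor_assoc, Nat.xor_self, Nat.xor_zero]
  exact Finset.sum_nbij' (fun r => r ^^^ 2 ^ a) (fun r => r ^^^ 2 ^ a) hmem hmem
    (fun r _ => hinv r) (fun r _ => hinv r) fun r _ => rfl

/-- The generating function of the number of pairs of digits that are both `1`, for disjoint
pairs of positions. -/
theorem sum_pow_card_testBit {M : ℕ} (z : ℝ) (a b : ℕ → ℕ) (K : Finset ℕ)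
    (ha : ∀ k ∈ K, a k < M) (hb : ∀ k ∈ K, b k < M) (hab : ∀ k ∈ K, ∀ l ∈ K, a k ≠ b l)
    (haa : ∀ k ∈ K, ∀ l ∈ K, a k = a l → k = l) (hbb : ∀ k ∈ K, ∀ l ∈ K, b k = b l → k = l) :
    ∑ r ∈ Finset.range (2 ^ M),
      z ^ (K.filter fun k => r.testBit (a k) = true ∧ r.testBit (b k) = true).card =
      2 ^ M * ((3 + z) / 4) ^ K.card := by
  induction K using Finset.induction_on with
  | empty => simp
  | insert k K hk ih =>
    simp only [Finset.forall_mem_insert] at ha hb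
    have ih := ih ha.2 hb.2 (fun i hi j hj => hab i (by simp [hi]) j (by simp [hj]))
      (fun i hi j hj => haa i (by simp [hi]) j (by simp [hj]))
      (fun i hi j hj => hbb i (by simp [hi]) j (by simp [hj]))
    set w : ℕ → ℝ := fun r =>
      z ^ (K.filter fun k => r.testBit (a k) = true ∧ r.testBit (b k) = true).card with hw
    set h : ℕ → ℝ := fun r =>
      if r.testBit (a k) = true ∧ r.testBit (b k) = true then z else 1 with hh
    have hsplit : ∀ r : ℕ, z ^ ((insert k K).filter fun k =>
        r.testBit (a k) = true ∧ r.testBit (b k) = true).card = w r * h r := by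
      intro r
      simp only [hw, hh]
      rw [Finset.filter_insert]
      split_ifs
      · rw [Finset.card_insert_of_notMem (by simp [hk]), pow_succ]
      · rw [mul_one]
    have hwa : ∀ r, w (r ^^^ 2 ^ a k) = w r := by
      intro r
      simp only [hw]
      congr 2
      refine Finset.filter_congr fun l hl => ?_
      have h1 : a k ≠ a l := fun e =>
        hk (by rw [haa k (by simp) l (by simp [hl]) e]; exact hl)
      have h2 : a k ≠ b l := hab k (by simp) l (by simp [hl])
      simp [Nat.testBit_xor, Nat.testBit_two_pow_of_ne h1, Nat.testBit_two_pow_of_ne h2]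
    have hwb : ∀ r, w (r ^^^ 2 ^ b k) = w r := by
      intro r
      simp only [hw]
      congr 2
      refine Finset.filter_congr fun l hl => ?_
      have h1 : b k ≠ b l := fun e =>
        hk (by rw [hbb k (by simp) l (by simp [hl]) e]; exact hl)
      have h2 : b k ≠ a l := (hab l (by simp [hl]) k (by simp)).symm
      simp [Nat.testBit_xor, Nat.testBit_two_pow_of_ne h1, Nat.testBit_two_pow_of_ne h2]
    have hne : a k ≠ b k := hab k (by simp) k (by simp)
    -- The four flips run through all values of the two digits: three contribute 1, and both digits
    -- 1 contributes `z`.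
    have hfour : ∀ r, h r + h (r ^^^ 2 ^ a k) + h (r ^^^ 2 ^ b k) +
        h (r ^^^ 2 ^ a k ^^^ 2 ^ b k) = 3 + z := by
      intro r
      simp only [hh, Nat.testBit_xor, Nat.testBit_two_pow_of_ne hne,
        Nat.testBit_two_pow_of_ne hne.symm, Nat.testBit_two_pow_self]
      cases r.testBit (a k) <;> cases r.testBit (b k) <;> simp <;> ring
    simp only [hsplit, Finset.card_insert_of_notMem hk]
    -- The sums over the four flipped copies are equal, so each is a quarter of their total `e4`.
    have e1 := sum_xor_two_pow ha.1 fun r => w r * h r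
    have e2 := sum_xor_two_pow hb.1 fun r => w r * h r
    have e3 := sum_xor_two_pow ha.1 fun r => w (r ^^^ 2 ^ b k) * h (r ^^^ 2 ^ b k)
    have e4 : ∑ r ∈ Finset.range (2 ^ M), (w r * h r + w (r ^^^ 2 ^ a k) * h (r ^^^ 2 ^ a k) +
        w (r ^^^ 2 ^ b k) * h (r ^^^ 2 ^ b k) +
        w (r ^^^ 2 ^ a k ^^^ 2 ^ b k) * h (r ^^^ 2 ^ a k ^^^ 2 ^ b k)) =
        ∑ r ∈ Finset.range (2 ^ M), w r * (3 + z) := by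
      refine Finset.sum_congr rfl fun r _ => ?_
      simp only [hwa, hwb]
      rw [← hfour r]
      ring
    rw [Finset.sum_add_distrib, Finset.sum_add_distrib, Finset.sum_add_distrib,
      ← Finset.sum_mul, ih] at e4
    rw [pow_succ]
    linarith

/-- Markov's inequality for `z ^ (number of common neighbors)`. With `z = w ^ (4 * q + 1)`, the
threshold qn/(4q+1) turns into the integer exponent `q * n`. -/
theorem card_sparse_pair_le {q n i j : ℕ} (hij : i < j) (hj : j < n) {w : ℝ} (hw0 : 0 < w)
    (hw1 : w < 1) :
    (((Finset.range (2 ^ (edgePairs n).length)).filter fun r =>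
      (4 * q + 1) * (commonNeighborList n r i j).length < q * n).card : ℝ) * w ^ (q * n) ≤
      2 ^ (edgePairs n).length * ((3 + w ^ (4 * q + 1)) / 4) ^ (n - 2) := by
  set M := (edgePairs n).length with hM
  -- For nodes k other than i and j, the positions of {i, k} and {j, k} are all distinct.
  set K := ((Finset.range n).erase i).erase j with hK
  have hmem : ∀ k ∈ K, k ≠ i ∧ k ≠ j ∧ k < n := by
    intro k hk
    simp only [hK, Finset.mem_erase, Finset.mem_range] at hk
    tauto
  have hcard : K.card = n - 2 := by
    rw [hK, Finset.card_erase_of_mem, Finset.card_erase_of_mem, Finset.card_range]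
    · omega
    · simp; omega
    · simp; omega
  have hi : i < n := hij.trans hj
  have key := sum_pow_card_testBit (M := M) (w ^ (4 * q + 1)) (edgeIndex n i) (edgeIndex n j) K
    (fun k hk => edgeIndex_lt hi (hmem k hk).2.2 (hmem k hk).1.symm)
    (fun k hk => edgeIndex_lt hj (hmem k hk).2.2 (hmem k hk).2.1.symm)
    (fun k hk l hl e => by
      have h1 := hmem k hk
      have h2 := hmem l hl
      have := edgeIndex_inj hi h1.2.2 h1.1.symm e
      omega)
    (fun k hk l hl e => by
      have h1 := hmem k hk
      have h2 := hmem l hl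
      have := edgeIndex_inj hi h1.2.2 h1.1.symm e
      omega)
    (fun k hk l hl e => by
      have h1 := hmem k hk
      have h2 := hmem l hl
      have := edgeIndex_inj hj h1.2.2 h1.2.1.symm e
      omega)
  rw [← hcard, ← key, ← nsmul_eq_mul, ← Finset.sum_const]
  refine (Finset.sum_le_sum fun r hr => ?_).trans (Finset.sum_le_sum_of_subset_of_nonneg
    (Finset.filter_subset _ _) fun r _ _ => by positivity)
  rw [← pow_mul]
  refine pow_le_pow_of_le_one hw0.le hw1.le (le_of_lt ?_)
  refine lt_of_le_of_lt (Nat.mul_le_mul_left _ ?_) (Finset.mem_filter.1 hr).2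
  rw [← List.toFinset_card_of_nodup (nodup_commonNeighborList n r i j)]
  refine Finset.card_le_card fun k hk => ?_
  rw [Finset.mem_filter] at hk
  rw [List.mem_toFinset, commonNeighborList, List.mem_filter]
  exact ⟨List.mem_range.2 (hmem k hk.1).2.2, by simpa using hk.2⟩

theorem length_sparseCodes_mul_le (q n : ℕ) {w : ℝ} (hw0 : 0 < w) (hw1 : w < 1) :
    ((sparseCodes q n).length : ℝ) * w ^ (q * n) ≤
      n ^ 2 * (2 ^ (edgePairs n).length * ((3 + w ^ (4 * q + 1)) / 4) ^ (n - 2)) := by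
  set M := (edgePairs n).length with hM
  have h1 : (sparseCodes q n).length ≤ ∑ e ∈ (edgePairs n).toFinset,
      ((Finset.range (2 ^ M)).filter fun r =>
        (4 * q + 1) * (commonNeighborList n r e.1 e.2).length < q * n).card := by
    rw [← List.toFinset_card_of_nodup (nodup_sparseCodes q n)]
    refine (Finset.card_le_card fun r hr => ?_).trans Finset.card_biUnion_le
    rw [List.mem_toFinset, sparseCodes, List.mem_filter] at hr
    obtain ⟨e, he, hlt⟩ := of_decide_eq_true hr.2
    rw [Finset.mem_biUnion]
    exact ⟨e, List.mem_toFinset.2 he,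
      Finset.mem_filter.2 ⟨Finset.mem_range.2 (List.mem_range.1 hr.1), hlt⟩⟩
  have h2 : ((sparseCodes q n).length : ℝ) ≤ ∑ e ∈ (edgePairs n).toFinset,
      (((Finset.range (2 ^ M)).filter fun r =>
        (4 * q + 1) * (commonNeighborList n r e.1 e.2).length < q * n).card : ℝ) := by
    exact_mod_cast h1
  refine (mul_le_mul_of_nonneg_right h2 (by positivity)).trans ?_
  rw [Finset.sum_mul]
  refine (Finset.sum_le_card_nsmul _ _ (2 ^ M * ((3 + w ^ (4 * q + 1)) / 4) ^ (n - 2))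
    fun e he => ?_).trans ?_
  · have := mem_edgePairs.1 (List.mem_toFinset.1 he)
    exact card_sparse_pair_le this.1 this.2 hw0 hw1
  · rw [nsmul_eq_mul]
    refine mul_le_mul_of_nonneg_right ?_ (by positivity)
    exact_mod_cast (List.toFinset_card_le _).trans (length_edgePairs_le_sq n)

/-- At x = 1 the function 4x^q - 3 - x^(4q+1) vanishes with derivative 4q - (4q+1) = -1, so it is
positive just to the left of 1. The slope is negative because q/(4q+1) < 1/4. -/
theorem exists_three_add_pow_lt (q : ℕ) :
    ∃ w : ℝ, 0 < w ∧ w < 1 ∧ (3 + w ^ (4 * q + 1)) / 4 < w ^ q := by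
  have hd : HasDerivAt (fun x : ℝ => 4 * x ^ q - 3 - x ^ (4 * q + 1)) (-1) 1 := by
    have := (((hasDerivAt_pow q (1 : ℝ)).const_mul 4).sub_const 3).sub
      (hasDerivAt_pow (4 * q + 1) (1 : ℝ))
    refine this.congr_deriv ?_
    push_cast
    simp only [one_pow]
    ring
  have h0 := hd.hasDerivWithinAt (s := Set.Iio 1)
  have hs := (hasDerivWithinAt_iff_tendsto_slope' (by simp)).1 h0
  have h1 := hs.eventually (gt_mem_nhds (show (-1 : ℝ) < 0 by norm_num))
  have h2 : ∀ᶠ x : ℝ in nhdsWithin 1 (Set.Iio 1), x ∈ Set.Ioo (0 : ℝ) 1 :=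
    Ioo_mem_nhdsLT one_pos
  obtain ⟨w, hw, hw0, hw1⟩ := (h1.and h2).exists
  refine ⟨w, hw0, hw1, ?_⟩
  rw [slope_def_field, div_neg_iff] at hw
  norm_num at hw
  rcases hw with hw | hw <;> linarith

/-- An exponentially small fraction of all graphs has a pair of nodes with few common
neighbors. -/
theorem exists_length_sparseCodes_le (q : ℕ) : ∃ σ : ℝ, 0 < σ ∧ σ < 1 ∧ ∀ n ≥ 2,
    ((sparseCodes q n).length : ℝ) ≤ 2 ^ (edgePairs n).length * (2 * n ^ 2 * σ ^ n) := by
  obtain ⟨w, hw0, hw1, hw⟩ := exists_three_add_pow_lt q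
  have hwq : 0 < w ^ q := by positivity
  set x := (3 + w ^ (4 * q + 1)) / 4 with hx
  have hx34 : 3 / 4 ≤ x := by
    have : 0 < w ^ (4 * q + 1) := by positivity
    rw [hx]; linarith
  refine ⟨x / w ^ q, by positivity, (div_lt_one hwq).2 hw, fun n hn => ?_⟩
  have h := length_sparseCodes_mul_le q n hw0 hw1
  rw [← hx] at h
  have hxn : x ^ (n - 2) ≤ 2 * x ^ n := by
    obtain ⟨m, rfl⟩ := Nat.exists_eq_add_of_le' hn
    have : 0 < x ^ m := by positivity
    rw [Nat.add_sub_cancel, pow_add]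
    -- Since x ≥ 3/4, 2x² ≥ 9/8; this is the source of the factor 2.
    have h2 : 1 ≤ 2 * x ^ 2 := by nlinarith
    nlinarith
  rw [div_pow, ← pow_mul]
  have hpos : 0 < w ^ (q * n) := by positivity
  calc ((sparseCodes q n).length : ℝ)
      ≤ n ^ 2 * (2 ^ (edgePairs n).length * x ^ (n - 2)) / w ^ (q * n) := by
        rwa [le_div_iff₀ hpos]
    _ ≤ n ^ 2 * (2 ^ (edgePairs n).length * (2 * x ^ n)) / w ^ (q * n) := by gcongr
    _ = _ := by ring

theorem eventually_length_sparseCodes_le (q : ℕ) : ∃ γ : ℝ, 0 < γ ∧ ∀ᶠ n : ℕ in atTop,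
    (sparseCodes q n).length ≤ 2 ^ ((edgePairs n).length - ⌊γ * n⌋₊) ∧
      (sparseCodes q n ≠ [] → ⌊γ * n⌋₊ ≤ (edgePairs n).length) := by
  obtain ⟨σ, hσ0, hσ1, hσ⟩ := exists_length_sparseCodes_le q
  -- Splitting σ^n as θ^n (σ/θ)^n lets θ^n absorb the factor 2n², while (σ/θ)^n = 2^(-γn) is the
  -- saving.
  obtain ⟨θ, hθ, hθ1⟩ := exists_between hσ1
  have hθ0 : 0 < θ := hσ0.trans hθ
  have hτ : 1 < θ / σ := (one_lt_div hσ0).2 hθ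
  refine ⟨Real.logb 2 (θ / σ), Real.logb_pos one_lt_two hτ, ?_⟩
  set γ := Real.logb 2 (θ / σ) with hγ
  have hlim : Tendsto (fun n : ℕ => (2 : ℝ) * (n ^ 2 * θ ^ n)) atTop (nhds (2 * 0)) :=
    (tendsto_pow_const_mul_const_pow_of_lt_one 2 hθ0.le hθ1).const_mul 2
  rw [mul_zero] at hlim
  filter_upwards [hlim.eventually (gt_mem_nhds one_pos), eventually_ge_atTop 2] with n hn hn2
  set M := (edgePairs n).length with hM
  set g := ⌊γ * n⌋₊ with hg
  have hg2 : (2 : ℝ) ^ g ≤ (θ / σ) ^ n := by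
    have hγ0 : 0 ≤ γ * n := mul_nonneg (Real.logb_pos one_lt_two hτ).le (Nat.cast_nonneg n)
    rw [← Real.rpow_natCast 2 g]
    calc (2 : ℝ) ^ (g : ℝ) ≤ 2 ^ (γ * n) :=
          Real.rpow_le_rpow_of_exponent_le one_le_two (Nat.floor_le hγ0)
      _ = (θ / σ) ^ n := by
          rw [Real.rpow_mul zero_le_two, hγ, Real.rpow_logb two_pos (by norm_num) (by positivity),
            Real.rpow_natCast]
  have hmain : ((sparseCodes q n).length : ℝ) * 2 ^ g ≤ 2 ^ M := by
    calc ((sparseCodes q n).length : ℝ) * 2 ^ g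
        ≤ 2 ^ M * (2 * n ^ 2 * σ ^ n) * (θ / σ) ^ n := by
          gcongr
          exact hσ n hn2
      _ = 2 ^ M * (2 * (n ^ 2 * θ ^ n)) := by
          rw [div_pow]; field_simp
      _ ≤ 2 ^ M * 1 := by gcongr
      _ = 2 ^ M := mul_one _
  have hnat : (sparseCodes q n).length * 2 ^ g ≤ 2 ^ M := by exact_mod_cast hmain
  -- The subtraction in the exponent truncates; it is genuine as soon as one sparse code exists.
  rcases (sparseCodes q n).eq_nil_or_concat with h0 | ⟨_, _, h0⟩
  · simp [h0]
  · have h1 : 1 ≤ (sparseCodes q n).length := by rw [h0]; simp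
    have hgM : g ≤ M := (Nat.pow_le_pow_iff_right one_lt_two).1
      ((Nat.le_mul_of_pos_left _ h1).trans hnat)
    refine ⟨?_, fun _ => hgM⟩
    rw [← Nat.sub_add_cancel hgM, pow_add] at hnat
    exact Nat.le_of_mul_le_mul_right hnat (by positivity)

/-! ### From common neighbors to connectivity -/

theorem isKConnected_of_le_ncard_commonNeighbors {n k : ℕ} (G : SimpleGraph (Fin n))
    (h : ∀ i j, i ≠ j → k ≤ (G.commonNeighbors i j).ncard) : IsKConnected G k := by
  classical
  intro i j hij
  let path : G.commonNeighbors i j → G.Path i j := fun v =>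
    ⟨.cons v.2.1 (.cons v.2.2.symm .nil), by
      have h1 := v.2.1.ne
      have h2 := v.2.2.ne
      rw [SimpleGraph.Walk.isPath_def]
      change [i, v.1, j].Nodup
      simp [h1, h2.symm, hij]⟩
  have hsupp : ∀ v, (path v).1.support = [i, v.1, j] := fun v => rfl
  have hinj : Function.Injective path := by
    intro v v' hvv
    have : [i, v.1, j] = [i, v'.1, j] := by rw [← hsupp, ← hsupp, hvv]
    simp only [List.cons.injEq, true_and, and_true] at this
    exact Subtype.ext this
  refine ⟨Finset.univ.image path, ?_, ?_⟩
  · rw [Finset.card_image_of_injective _ hinj, Finset.card_univ, ← Nat.card_eq_fintype_card]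
    exact h i j hij
  · intro P hP Q hQ hPQ v hvP hvQ
    obtain ⟨x, -, rfl⟩ := Finset.mem_image.1 hP
    obtain ⟨y, -, rfl⟩ := Finset.mem_image.1 hQ
    have hxy : x.1 ≠ y.1 := fun e => hPQ (congrArg path (Subtype.ext e))
    rw [hsupp] at hvP hvQ
    simp only [List.mem_cons, List.not_mem_nil, or_false] at hvP hvQ
    rcases hvP with h1 | h1 | h1
    · exact Or.inl h1
    · rcases hvQ with h2 | h2 | h2
      · exact Or.inl h2
      · exact absurd (h1.symm.trans h2) hxy
      · exact Or.inr h2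
    · exact Or.inr h1

theorem length_commonNeighborList_le {n r : ℕ} {G : SimpleGraph (Fin n)}
    (hr : ∀ i j : Fin n, r.testBit (edgeIndex n i j) = true ↔ G.Adj i j) (i j : Fin n) :
    (commonNeighborList n r i j).length ≤ (G.commonNeighbors i j).ncard := by
  classical
  rw [← List.toFinset_card_of_nodup (nodup_commonNeighborList n r i j),
    ← Set.ncard_image_of_injective _ Fin.val_injective, ← Set.ncard_coe_finset]
  refine Set.ncard_le_ncard (fun k hk => ?_) (Set.toFinite _)
  rw [Finset.mem_coe, List.mem_toFinset, commonNeighborList, List.mem_filter, List.mem_range,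
    decide_eq_true_eq] at hk
  refine ⟨⟨k, hk.1⟩, ⟨(hr i ⟨k, hk.1⟩).1 hk.2.1, (hr j ⟨k, hk.1⟩).1 hk.2.2⟩, rfl⟩

/-- Any two nodes of a random graph have almost a quarter of all nodes as common neighbors. -/
theorem eventually_le_ncard_commonNeighbors {U : Machine} (hU : IsUniversal U) {δ : ℕ → ℝ}
    (hδ : δ =o[atTop] fun n : ℕ => (n : ℝ)) (q : ℕ) :
    ∀ᶠ n : ℕ in atTop, ∀ G : SimpleGraph (Fin n), IsRandomGraph U δ G →
      ∀ i j, i ≠ j → q * n ≤ (4 * q + 1) * (G.commonNeighbors i j).ncard := by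
  obtain ⟨c, hc⟩ := exists_condComplexity_le hU q
  obtain ⟨γ, hγ, hev⟩ := eventually_length_sparseCodes_le q
  -- A sparse random graph would give γn - 1 < c + δ(n) ≤ c + γn/2, the 1 coming from the floor;
  -- this fails beyond 2(c+1)/γ.
  have hbig : ∀ᶠ n : ℕ in atTop, 2 * (c + 1 : ℝ) / γ < n :=
    tendsto_natCast_atTop_atTop.eventually_gt_atTop _
  filter_upwards [hev, hδ.bound (half_pos hγ), hbig] with n hn hδn hbn G hG i j hij
  obtain ⟨r, hr, hstr, hadj⟩ := exists_code G
  have hns : ¬ IsSparseCode q n r := by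
    intro hsp
    have hmem : r ∈ sparseCodes q n := by
      rw [sparseCodes, List.mem_filter]
      exact ⟨List.mem_range.2 hr, decide_eq_true hsp⟩
    have hC := hc n _ r hn.1 hmem
    have hgM := hn.2 (List.ne_nil_of_mem hmem)
    have hM := length_edgePairs_le n
    rw [← hstr] at hC
    have hC' : condComplexity U (edgeString G) n + ⌊γ * n⌋₊ ≤ c + n.choose 2 := by omega
    have hC'' : (condComplexity U (edgeString G) n : ℝ) + ⌊γ * n⌋₊ ≤ c + n.choose 2 := by
      exact_mod_cast hC'
    have hfl := Nat.lt_floor_add_one (γ * n)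
    rw [IsRandomGraph] at hG
    rw [Real.norm_of_nonneg (Nat.cast_nonneg n)] at hδn
    have := (le_abs_self _).trans hδn
    rw [div_lt_iff₀ hγ] at hbn
    linarith
  have key : ∀ a b : Fin n, a < b → q * n ≤ (4 * q + 1) * (G.commonNeighbors a b).ncard := by
    intro a b hab
    by_contra hlt
    refine hns ⟨(a, b), mem_edgePairs.2 ⟨hab, b.2⟩, ?_⟩
    exact lt_of_le_of_lt (Nat.mul_le_mul_left _ (length_commonNeighborList_le hadj a b))
      (not_le.1 hlt)
  rcases lt_or_gt_of_ne hij with h | h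
  · exact key i j h
  · rw [G.commonNeighbors_symm]
    exact key j i h

theorem mainTheorem7 (U : Machine) (hU : IsUniversal U) (δ : ℕ → ℝ)
    (hδ : δ =o[atTop] fun n : ℕ => (n : ℝ)) :
    ∃ κ : ℕ → ℕ, ((fun n : ℕ => (κ n : ℝ) - (n : ℝ) / 4) =o[atTop] fun n : ℕ => (n : ℝ)) ∧
      ∀ (n : ℕ) (G : SimpleGraph (Fin n)), IsRandomGraph U δ G → IsKConnected G (κ n) := by
  classical
  -- κ(n) is the largest k ≤ n/4 with this property, so one function serves every q. The cap n/4
  -- gives the upper estimate, even where no graph is random; k = 0 always qualifies.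
  let P : ℕ → ℕ → Prop := fun n k => ∀ G : SimpleGraph (Fin n), IsRandomGraph U δ G →
    ∀ i j, i ≠ j → k ≤ (G.commonNeighbors i j).ncard
  refine ⟨fun n => Nat.findGreatest (P n) (n / 4), ?_, fun n G hG => ?_⟩
  · refine isLittleO_iff.2 fun ε hε => ?_
    -- The shortfall n/4 - qn/(4q+1) = n/(4(4q+1)) is then below εn/2; the other εn/2 > 1 pays for
    -- rounding.
    obtain ⟨q, hq⟩ := exists_nat_gt (1 / ε)
    have hbig : ∀ᶠ n : ℕ in atTop, 2 / ε < (n : ℝ) :=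
      tendsto_natCast_atTop_atTop.eventually_gt_atTop _
    filter_upwards [eventually_le_ncard_commonNeighbors hU hδ q, hbig] with n hn hbn
    have hlow : q * n / (4 * q + 1) ≤ Nat.findGreatest (P n) (n / 4) := by
      refine Nat.le_findGreatest ?_ fun G hG i j hij => ?_
      · have hq0 : 0 < q := Nat.cast_pos.1 ((one_div_pos.2 hε).trans hq)
        rw [← Nat.mul_div_mul_left n 4 hq0]
        exact Nat.div_le_div_left (by omega) (by omega)
      · exact Nat.div_le_of_le_mul (hn G hG i j hij)
    have hup : Nat.findGreatest (P n) (n / 4) ≤ n / 4 := Nat.findGreatest_le _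
    set k := Nat.findGreatest (P n) (n / 4)
    have hup' : (k : ℝ) ≤ n / 4 := (Nat.cast_le.2 hup).trans Nat.cast_div_le
    have hlow' : q * n < (4 * q + 1) * (k + 1) := by
      have := Nat.lt_mul_div_succ (q * n) (Nat.succ_pos (4 * q))
      exact this.trans_le (Nat.mul_le_mul_left _ (Nat.succ_le_succ hlow))
    have hlow'' : (q : ℝ) * n < (4 * q + 1) * (k + 1) := by exact_mod_cast hlow'
    rw [Real.norm_of_nonneg (Nat.cast_nonneg n), Real.norm_eq_abs, abs_le]
    have hn0 : (0 : ℝ) ≤ n := Nat.cast_nonneg n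
    rw [div_lt_iff₀ hε] at hq hbn
    have hq0 : (0 : ℝ) ≤ q := Nat.cast_nonneg q
    constructor
    · have h1 : (n : ℝ) / 4 < (4 * q + 1) * (k + 1 - n / 4) + n / 2 := by linarith
      have h2 : (0 : ℝ) < 4 * q + 1 := by positivity
      by_contra hcon
      push Not at hcon
      have h3 : (k : ℝ) + 1 - n / 4 < - (ε * n / 2) := by linarith
      nlinarith [mul_nonneg hq0 hn0, mul_le_mul_of_nonneg_right hq.le hn0]
    · have := mul_nonneg hε.le hn0
      linarith
  · exact isKConnected_of_le_ncard_commonNeighbors G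
      (Nat.findGreatest_spec (P := P n) (Nat.zero_le _) (fun _ _ _ _ _ => Nat.zero_le _) G hG)
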